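/- Let $\mathcal G$ be the class of continuous non-decreasing $\gamma:\mathbb R_{\ge0}\to\mathbb R_{\ge0}$ with $\gamma(0)=0$, and $\mathcal K_\infty$ the class of strictly increasing unbounded elements of $\mathcal G$. Let $f:\mathbb R^n\times\mathbb R^c\times\mathbb R^m\to\mathbb R^n$ be locally Lipschitz, let $A\subset\mathbb R^n$ be compact with $0\in A$, and write $|y|_A=\inf_{a\in A}|y-a|$. Suppose that $A$ is input-to-state stabilizable with gain $\tilde\gamma$ in the absence of delay for $\dot x(t)=f(x(t),u(t-\tilde\delta),w(t))$ through the feedback $k$, i.e. $k:\mathbb R^n\to\mathbb R^c$ is smooth and there are $\alpha_1,\alpha_2,\alpha_3\in\mathcal K_\infty$, $\gamma\in\mathcal G$ and a smooth $V:\mathbb R^n\to\mathbb R_{\ge0}$ such that $\tilde\gamma=\alpha_1^{-1}\circ\alpha_2\circ\gamma$ and, for all $x\in\mathbb R^n$, $w\in\mathbb R^m$, $$\alpha_1(|x|_A)\le V(x)\le\alpha_2(|x|_A),\qquad |x|_A\ge\gamma(|w|)\ \Longrightarrow\ \frac{\partial V}{\partial x}(x)\,f(x,k(x),w)\le-\alpha_3(|x|_A).$$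 For $\tilde\delta>0$ and a window length $r\in[\tilde\delta,2\tilde\delta]$ consider the delayed closed loop $$\dot x(t)=f\big(x(t),k(x(t-\tilde\delta)),w(t)\big),\quad t\ge t_0,\qquad x(t_0+s)=\xi(s),\quad -r\le s\le0,\tag{1}$$ with $t_0>0$, $\xi$ continuous and $w:[-r,\infty)\to\mathbb R^m$ bounded and piecewise continuous; solutions are continuous functions satisfying the integrated equation. Put $$|\xi|_A=\inf_{a\in A}\max_{-r\le s\le0}|a-\xi(s)|,\quad x_t(s)=x(t+s)\ (-r\le s\le 0),\quad \|x\|_{t_1,A}=\sup_{t\ge t_1}|x_t|_A,\quad \|w\|_{t_0}=\sup_{t\ge t_0-r}|w(t)|.$$ Given $\mu\ge0$ and $\Delta_x,\Delta_w\in[0,\infty]$, the set $A$ is called uniformly ISS for (1) with gain $\tilde\gamma\in\mathcal G$, offset $\mu$ and restriction $(\Delta_x,\Delta_w)$ if, whenever $|\xi|_A<\Delta_x$ and $\|w\|_{t_0}<\Delta_w$, a maximal solution of (1) exists and every maximal solution $x$ is defined for all $t\ge t_0$, and if, for such data, uniformly in $t_0>0$: 1. for each $\epsilon>0$ there is $d>0$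 such that $|\xi|_A\le d$ implies $\|x\|_{t_0,A}\le\max\{\epsilon,\tilde\gamma(\|w\|_{t_0}),\mu\}$; 2. for each $\epsilon>0$, $\eta_x\in(0,\Delta_x)$, $\eta_w\in(0,\Delta_w)$ there is $T>0$ such that $|\xi|_A\le\eta_x$ and $\|w\|_{t_0}\le\eta_w$ imply $\|x\|_{t_0+T,A}\le\max\{\epsilon,\tilde\gamma(\|w\|_{t_0}),\mu\}$. Then there are $\delta^*>0$ and finite quantities $\mu(\tilde\delta),\Delta_x(\tilde\delta),\Delta_w(\tilde\delta)$ that are positive for $\tilde\delta\in(0,\delta^*)$, such that for every $\tilde\delta\in(0,\delta^*)$ and every $r\in[\tilde\delta,2\tilde\delta]$ the set $A$ is uniformly ISS for (1) with the same gain $\tilde\gamma$, offset $\mu(\tilde\delta)$ and restriction $(\Delta_x(\tilde\delta),\Delta_w(\tilde\delta))$; moreover $\mu(\tilde\delta)\to0$, $\Delta_x(\tilde\delta)\to\infty$ and $\Delta_w(\tilde\delta)\to\infty$ as $\tilde\delta\to0^+$. -/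

import Mathlib

open Set Filter Topology MeasureTheory
open scoped NNReal ENNReal ContDiff

namespace DelayISS

/-- Class `𝒢`: continuous, zero at zero, non-decreasing. -/
structure ClassG (γ : ℝ≥0 → ℝ≥0) : Prop where
  continuous : Continuous γ
  map_zero : γ 0 = 0
  monotone : Monotone γ

/-- Class `𝒦_∞`: class `𝒢`, strictly increasing and unbounded. -/
structure ClassKInf (α : ℝ≥0 → ℝ≥0) : Prop where
  classG : ClassG α
  strictMono : StrictMono α
  unbounded : ¬ BddAbove (range α)

section FDE

variable {E W : Type*} [NormedAddCommGroup E] [NormedSpace ℝ E] [NormedAddCommGroup W]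

/-- The segment `x_t(s) = x(t + s)`, `-r ≤ s ≤ 0`, of a signal, set to zero off the window so that
a functional of the segment sees the window only. -/
noncomputable def seg {X : Type*} [Zero X] (r : ℝ) (x : ℝ → X) (t : ℝ) : ℝ → X :=
  (Icc (-r) 0).indicator fun s => x (t + s)

/-- `|φ|_A = inf_{a ∈ A} max_{-r ≤ s ≤ 0} |a - φ(s)|`. -/
noncomputable def segDist (r : ℝ) (A : Set E) (φ : ℝ → E) : ℝ≥0∞ :=
  ⨅ a ∈ A, ⨆ s ∈ Icc (-r) 0, edist a (φ s)

/-- `‖x_t‖_{t₀,A} = sup_{t ≥ t₀} |x_t|_A`. -/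
noncomputable def supSegDist (r : ℝ) (A : Set E) (x : ℝ → E) (t₀ : ℝ) : ℝ≥0∞ :=
  ⨆ t ∈ Ici t₀, segDist r A (seg r x t)

/-- `‖w_t‖_{t₀} = sup_{t ≥ t₀} max_{-r ≤ s ≤ 0} |w(t + s)|`. -/
noncomputable def supSegNorm (r : ℝ) (w : ℝ → W) (t₀ : ℝ) : ℝ≥0∞ :=
  ⨆ t ∈ Ici t₀, ⨆ s ∈ Icc (-r) 0, ‖w (t + s)‖ₑ

/-- Piecewise continuity on `[a, ∞)`: finitely many discontinuities on each bounded interval, and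
finite one-sided limits everywhere. -/
structure PiecewiseContinuousFrom (w : ℝ → W) (a : ℝ) : Prop where
  finite : ∀ b, {t ∈ Icc a b | ¬ ContinuousWithinAt w (Ici a) t}.Finite
  right_lim : ∀ t, a ≤ t → ∃ l, Tendsto w (𝓝[>] t) (𝓝 l)
  left_lim : ∀ t, a < t → ∃ l, Tendsto w (𝓝[<] t) (𝓝 l)

/-- Admissible disturbances: bounded and piecewise continuous on `[-r, ∞)`. -/
structure IsDisturbance (r : ℝ) (w : ℝ → W) : Prop where
  bounded : ∃ C, ∀ t, -r ≤ t → ‖w t‖ ≤ C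
  piecewise : PiecewiseContinuousFrom w (-r)

/-- `x` is a solution on `[t₀ - r, t₀ + T)` of `ẋ(t) = F(t, x_t, w_t)` with initial segment `ξ` at
time `t₀`. As `w` may jump, the equation is taken in integrated form. -/
structure IsSolution (r : ℝ) (F : ℝ → (ℝ → E) → (ℝ → W) → E) (w : ℝ → W) (t₀ : ℝ) (ξ : ℝ → E)
    (T : ℝ≥0∞) (x : ℝ → E) : Prop where
  pos : 0 < T
  init : ∀ s ∈ Icc (-r) 0, x (t₀ + s) = ξ s
  continuousOn : ContinuousOn x {t | t₀ - r ≤ t ∧ ENNReal.ofReal (t - t₀) < T}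
  integrable : ∀ t, t₀ ≤ t → ENNReal.ofReal (t - t₀) < T →
    IntervalIntegrable (fun s => F s (seg r x s) (seg r w s)) volume t₀ t
  eqn : ∀ t, t₀ ≤ t → ENNReal.ofReal (t - t₀) < T →
    x t = x t₀ + ∫ s in t₀..t, F s (seg r x s) (seg r w s)

/-- A solution that has no extension to a longer interval; `T` is its existence time `T_f`. -/
def IsMaximalSolution (r : ℝ) (F : ℝ → (ℝ → E) → (ℝ → W) → E) (w : ℝ → W) (t₀ : ℝ) (ξ : ℝ → E)
    (T : ℝ≥0∞) (x : ℝ → E) : Prop :=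
  IsSolution r F w t₀ ξ T x ∧
    ∀ (T' : ℝ≥0∞) (x' : ℝ → E), IsSolution r F w t₀ ξ T' x' → T ≤ T' →
      (∀ t, t₀ ≤ t → ENNReal.ofReal (t - t₀) < T → x' t = x t) → T' = T

/-- The data of an initial value problem at time `t₀` within the restriction `(Δx, Δw)`. -/
structure IsAdmissible (r : ℝ) (A : Set E) (Δx Δw : ℝ≥0∞) (w : ℝ → W) (t₀ : ℝ)
    (ξ : ℝ → E) : Prop where
  pos : 0 < t₀
  disturbance : IsDisturbance r w
  continuousOn : ContinuousOn ξ (Icc (-r) 0)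
  init_lt : segDist r A ξ < Δx
  dist_lt : supSegNorm r w t₀ < Δw

/-- The set `A` is uniformly ISS for `ẋ(t) = F(t, x_t, w_t)` (segments of length `r`) with gain `γ`,
offset `μ` and restriction `(Δx, Δw)`. -/
structure UniformlyISS (r : ℝ) (F : ℝ → (ℝ → E) → (ℝ → W) → E) (A : Set E) (γ : ℝ≥0 → ℝ≥0)
    (μ : ℝ≥0) (Δx Δw : ℝ≥0∞) : Prop where
  gain : ClassG γ
  exists_maximal : ∀ w t₀ ξ, IsAdmissible r A Δx Δw w t₀ ξ →
    ∃ T x, IsMaximalSolution r F w t₀ ξ T x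
  global : ∀ w t₀ ξ, IsAdmissible r A Δx Δw w t₀ ξ →
    ∀ T x, IsMaximalSolution r F w t₀ ξ T x → T = ⊤
  stable : ∀ ε : ℝ≥0, 0 < ε → ∃ d : ℝ≥0, 0 < d ∧
    ∀ w t₀ ξ, IsAdmissible r A Δx Δw w t₀ ξ → segDist r A ξ ≤ d →
      ∀ T x, IsMaximalSolution r F w t₀ ξ T x →
        supSegDist r A x t₀ ≤ (max ε (max (γ (supSegNorm r w t₀).toNNReal) μ) : ℝ≥0)
  convergent : ∀ ε ηx ηw : ℝ≥0, 0 < ε → 0 < ηx → (ηx : ℝ≥0∞) < Δx → 0 < ηw → (ηw : ℝ≥0∞) < Δw →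
    ∃ τ : ℝ, 0 < τ ∧
      ∀ w t₀ ξ, IsAdmissible r A Δx Δw w t₀ ξ → segDist r A ξ ≤ ηx → supSegNorm r w t₀ ≤ ηw →
        ∀ T x, IsMaximalSolution r F w t₀ ξ T x →
          supSegDist r A x (t₀ + τ) ≤ (max ε (max (γ (supSegNorm r w t₀).toNNReal) μ) : ℝ≥0)

end FDE

section Stabilization

variable {E U W : Type*} [NormedAddCommGroup E] [NormedSpace ℝ E]
  [NormedAddCommGroup U] [NormedSpace ℝ U] [NormedAddCommGroup W]

/-- In the absence of delay the feedback `u = k(x)` input-to-state stabilizes `A` for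
`ẋ = f(x, u, w)` with gain `γt = α₁⁻¹ ∘ α₂ ∘ γ`. -/
def StabilizedWithGain (f : E → U → W → E) (A : Set E) (k : E → U) (γt : ℝ≥0 → ℝ≥0) : Prop :=
  ContDiff ℝ ∞ k ∧
  ∃ (α₁ α₂ α₃ γ : ℝ≥0 → ℝ≥0) (V : E → ℝ),
    ClassKInf α₁ ∧ ClassKInf α₂ ∧ ClassKInf α₃ ∧ ClassG γ ∧ ContDiff ℝ ∞ V ∧
    (∀ x, (α₁ (Metric.infNndist x A) : ℝ) ≤ V x ∧ V x ≤ α₂ (Metric.infNndist x A)) ∧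
    (∀ x w, γ ‖w‖₊ ≤ Metric.infNndist x A →
      fderiv ℝ V x (f x (k x) w) ≤ -(α₃ (Metric.infNndist x A) : ℝ)) ∧
    γt = Function.invFun α₁ ∘ α₂ ∘ γ

/-- The right-hand side of `ẋ(t) = f(x(t), k(x(t - δ)), w(t))` as a functional of segments. -/
def closedLoop (f : E → U → W → E) (k : E → U) (δ : ℝ) :
    ℝ → (ℝ → E) → (ℝ → W) → E :=
  fun _ φ v => f (φ 0) (k (φ (-δ))) (v 0)

end Stabilization

end DelayISS

/-! The delay is a small perturbation of the undelayed loop: on a bounded set the speed is at most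
some `M`, so after one delay `x(t)` and `x(t - δ)` differ by at most `M * δ`. By compactness, away
from `A` the decrease of `V` survives a small error `σ` in the feedback argument, and even holds on
the slightly larger region `γ(|w|) ≤ |x|_A + σ` (`exists_decrease_margin`). Trajectories therefore
enter a sublevel set of `V` belonging to `γ(|w|) - σ` rather than `γ(|w|)`. Since `α₁⁻¹ ∘ α₂` is
strictly increasing, this gains a fixed slack `κ` (`exists_add_le_apply_add`), which pays for the
oscillation of `x` over a window. This is why the gain is unchanged; only near `A` does the offset
have to absorb the error.

The bound `M` presupposes bounded trajectories. The circle is broken by solving an equation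
retracted to a ball (`exists_retracted_solution`) and showing with `V` that its solution never
leaves the ball. For fixed offset and restrictions this gives all small delays
(`exists_delay_uniformlyISS`); a diagonal choice (`exists_level_tendsto_atTop`) lets them vary with
`δ`. -/

namespace DelayISS

/-! ### Radial retraction onto a ball -/

section Retraction

variable {E : Type*} [NormedAddCommGroup E] [NormedSpace ℝ E]

/-- The radial retraction onto the closed ball of radius `R` about the origin. -/
noncomputable def ballRetract (R : ℝ) (x : E) : E := (R / max R ‖x‖) • x

theorem norm_ballRetract_le {R : ℝ} (hR : 0 < R) (x : E) : ‖ballRetract R x‖ ≤ R := by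
  have hm : 0 < max R ‖x‖ := lt_max_of_lt_left hR
  rw [ballRetract, norm_smul, Real.norm_of_nonneg (by positivity), div_mul_eq_mul_div,
    div_le_iff₀ hm]
  exact mul_le_mul_of_nonneg_left (le_max_right _ _) hR.le

theorem ballRetract_eq_self {R : ℝ} (hR : 0 < R) {x : E} (hx : ‖x‖ ≤ R) : ballRetract R x = x := by
  rw [ballRetract, max_eq_left hx, div_self hR.ne', one_smul]

/-- Moving the point and changing the scaling factor each cost at most `‖x - y‖`; no inner product
is needed. -/
theorem norm_ballRetract_sub_le {R : ℝ} (hR : 0 < R) (x y : E) :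
    ‖ballRetract R x - ballRetract R y‖ ≤ 2 * ‖x - y‖ := by
  have hx : 0 < max R ‖x‖ := lt_max_of_lt_left hR
  have hy : 0 < max R ‖y‖ := lt_max_of_lt_left hR
  have hsplit : ballRetract R x - ballRetract R y =
      (R / max R ‖x‖) • (x - y) + (R / max R ‖x‖ - R / max R ‖y‖) • y := by
    simp only [ballRetract, smul_sub, sub_smul]; abel
  have h₁ : ‖(R / max R ‖x‖) • (x - y)‖ ≤ ‖x - y‖ := by
    rw [norm_smul, Real.norm_of_nonneg (by positivity)]
    exact mul_le_of_le_one_left (norm_nonneg _) ((div_le_one hx).2 (le_max_left _ _))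
  have hmax : |max R ‖y‖ - max R ‖x‖| ≤ ‖x - y‖ :=
    (show |max R ‖y‖ - max R ‖x‖| ≤ |‖y‖ - ‖x‖| by
      simpa using abs_max_sub_max_le_max R ‖y‖ R ‖x‖).trans
      ((abs_norm_sub_norm_le y x).trans_eq (norm_sub_rev _ _))
  have h₂ : ‖(R / max R ‖x‖ - R / max R ‖y‖) • y‖ ≤ ‖x - y‖ := by
    have heq : R / max R ‖x‖ - R / max R ‖y‖ =
        (R / max R ‖x‖) * ((max R ‖y‖ - max R ‖x‖) / max R ‖y‖) := by
      field_simp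
    rw [norm_smul, heq, norm_mul, Real.norm_of_nonneg (by positivity : 0 ≤ R / max R ‖x‖), norm_div,
      Real.norm_of_nonneg hy.le, Real.norm_eq_abs]
    calc R / max R ‖x‖ * (|max R ‖y‖ - max R ‖x‖| / max R ‖y‖) * ‖y‖
        = R / max R ‖x‖ * (|max R ‖y‖ - max R ‖x‖| * (‖y‖ / max R ‖y‖)) := by ring
      _ ≤ 1 * (‖x - y‖ * 1) := by
          gcongr
          · exact (div_le_one hx).2 (le_max_left _ _)
          · exact (div_le_one hy).2 (le_max_right _ _)
      _ = ‖x - y‖ := by ring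
  rw [hsplit]
  linarith [norm_add_le ((R / max R ‖x‖) • (x - y)) ((R / max R ‖x‖ - R / max R ‖y‖) • y)]

theorem continuous_ballRetract {R : ℝ} (hR : 0 < R) : Continuous (ballRetract R : E → E) :=
  (LipschitzWith.of_dist_le_mul (K := 2) fun x y => by
    simpa [dist_eq_norm] using norm_ballRetract_sub_le hR x y).continuous

end Retraction

/-! ### Delayed integral equations: uniqueness and global existence -/

section Integral

variable {E : Type*} [NormedAddCommGroup E] [NormedSpace ℝ E]

theorem norm_integral_le_of_norm_le_exp {D : ℝ → E} {t₀ t C l : ℝ} (ht : t₀ ≤ t) (hC : 0 ≤ C)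
    (hl : 0 < l) (hD : ∀ s ∈ Ioc t₀ t, ‖D s‖ ≤ C * Real.exp (l * (s - t₀))) :
    ‖∫ s in t₀..t, D s‖ ≤ C / l * Real.exp (l * (t - t₀)) := by
  have hcont : Continuous fun s => C * Real.exp (l * (s - t₀)) := by fun_prop
  have hint := intervalIntegral.norm_integral_le_of_norm_le ht (Eventually.of_forall hD)
    (hcont.intervalIntegrable (μ := volume) t₀ t)
  have hval : ∫ s in t₀..t, C * Real.exp (l * (s - t₀)) =
      C / l * Real.exp (l * (t - t₀)) - C / l * Real.exp (l * (t₀ - t₀)) := by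
    refine intervalIntegral.integral_eq_sub_of_hasDerivAt
      (f := fun s => C / l * Real.exp (l * (s - t₀))) (fun s _ => ?_)
      (hcont.intervalIntegrable t₀ t)
    have h := ((((hasDerivAt_id s).sub_const t₀).const_mul l).exp).const_mul (C / l)
    refine h.congr_deriv ?_
    simp only [id]
    field_simp
  rw [hval] at hint
  have : 0 ≤ C / l * Real.exp (l * (t₀ - t₀)) := by positivity
  linarith

/-- A function vanishing up to `t₀` and satisfying a linear delayed integral inequality
vanishes. -/
theorem eq_zero_of_delay_integral {z D : ℝ → E} {t₀ t₁ δ L : ℝ} (hL : 0 ≤ L) (hδ : 0 ≤ δ)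
    (hz : ContinuousOn z (Icc t₀ t₁)) (hz₀ : ∀ t ∈ Icc (t₀ - δ) t₀, z t = 0)
    (hzD : ∀ t ∈ Icc t₀ t₁, z t = ∫ s in t₀..t, D s)
    (hD : ∀ s ∈ Icc t₀ t₁, ‖D s‖ ≤ L * (‖z s‖ + ‖z (s - δ)‖)) :
    ∀ t ∈ Icc t₀ t₁, z t = 0 := by
  intro t ht
  have hne : (Icc t₀ t₁).Nonempty := ⟨t, ht⟩
  have hcont : ContinuousOn (fun t => Real.exp (-((4 * L + 1) * (t - t₀))) * ‖z t‖)
      (Icc t₀ t₁) := ContinuousOn.mul (by fun_prop) hz.norm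
  -- At a maximum `m` of the exponentially weighted norm, the integral inequality gives `m ≤ 2 * L *
  -- m / (4 * L + 1)`, so `m = 0`.
  obtain ⟨τ, hτ, hmax⟩ := isCompact_Icc.exists_isMaxOn hne hcont
  set m := Real.exp (-((4 * L + 1) * (τ - t₀))) * ‖z τ‖ with hm
  have hm0 : 0 ≤ m := by positivity
  have hbound : ∀ s ∈ Icc t₀ t₁, ‖z s‖ ≤ m * Real.exp ((4 * L + 1) * (s - t₀)) := by
    intro s hs
    have h : Real.exp (-((4 * L + 1) * (s - t₀))) * ‖z s‖ ≤ m := hmax hs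
    rwa [Real.exp_neg, inv_mul_le_iff₀ (Real.exp_pos _), mul_comm] at h
  have hdelay : ∀ s ∈ Icc t₀ t₁, ‖z (s - δ)‖ ≤ m * Real.exp ((4 * L + 1) * (s - t₀)) := by
    intro s hs
    rcases le_total (s - δ) t₀ with h | h
    · rw [hz₀ _ ⟨by linarith [hs.1], h⟩, norm_zero]; positivity
    · refine (hbound _ ⟨h, by linarith [hs.2]⟩).trans ?_
      gcongr
      linarith
  have hle : ‖z τ‖ ≤ 2 * L * m / (4 * L + 1) * Real.exp ((4 * L + 1) * (τ - t₀)) := by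
    rw [hzD τ hτ]
    refine norm_integral_le_of_norm_le_exp hτ.1 (by positivity) (by positivity) fun s hs => ?_
    have hs' : s ∈ Icc t₀ t₁ := ⟨hs.1.le, hs.2.trans hτ.2⟩
    calc ‖D s‖ ≤ L * (‖z s‖ + ‖z (s - δ)‖) := hD s hs'
      _ ≤ L * (m * Real.exp ((4 * L + 1) * (s - t₀)) + m * Real.exp ((4 * L + 1) * (s - t₀))) := by
          gcongr
          · exact hbound s hs'
          · exact hdelay s hs'
      _ = _ := by ring
  have hmle : m ≤ 2 * L * m / (4 * L + 1) := by
    rwa [hm, Real.exp_neg, inv_mul_le_iff₀ (Real.exp_pos _), ← Real.exp_neg, ← hm, mul_comm]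
  rw [le_div_iff₀ (by positivity)] at hmle
  have hmz : m = 0 := by nlinarith
  have := hbound t ht
  rw [hmz, zero_mul] at this
  exact norm_le_zero_iff.1 this

/-- Banach's fixed point theorem in an exponentially weighted sup norm, which handles the whole
half-line at once. Present and delayed arguments contribute `L` each, and `2 * L / (4 * L + 1) ≤ 1 /
2`. -/
theorem exists_delay_integral_solution [CompleteSpace E] {G : ℝ → E → E → E} {M L δ t₀ : ℝ}
    (hL : 0 ≤ L) (hδ : 0 ≤ δ)
    (hmeas : ∀ X Z : ℝ → E, Continuous X → Continuous Z →
      AEStronglyMeasurable (fun s => G s (X s) (Z s)) volume)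
    (hbd : ∀ s x y, ‖G s x y‖ ≤ M)
    (hlip : ∀ s x y x' y', ‖G s x y - G s x' y'‖ ≤ L * (‖x - x'‖ + ‖y - y'‖))
    {ξ : ℝ → E} (hξ : Continuous ξ) :
    ∃ X : ℝ → E, Continuous X ∧ (∀ t ≤ t₀, X t = ξ t) ∧
      ∀ t, t₀ ≤ t → X t = ξ t₀ + ∫ s in t₀..t, G s (X s) (X (s - δ)) := by
  set l : ℝ := 4 * L + 1 with hl
  have hl0 : 0 < l := by positivity
  have hM : 0 ≤ M := (norm_nonneg _).trans (hbd 0 0 0)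
  -- The unknown `Y` is the rescaled increment over the initial data. A fixed point vanishes for `t
  -- ≤ t₀`, so `P Y` then restores `ξ` there.
  let P : BoundedContinuousFunction ℝ E → ℝ → E :=
    fun Y t => ξ (min t t₀) + Real.exp (l * (max t t₀ - t₀)) • Y t
  have hP : ∀ Y, Continuous (P Y) := fun Y => by
    have := Y.continuous
    exact (hξ.comp (by fun_prop)).add (Continuous.smul (by fun_prop) this)
  let H : BoundedContinuousFunction ℝ E → ℝ → E := fun Y s => G s (P Y s) (P Y (s - δ))
  have hH : ∀ Y a b, IntervalIntegrable (H Y) volume a b := fun Y a b =>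
    (intervalIntegrable_const (c := M)).mono_fun
      (hmeas _ _ (hP Y) ((hP Y).comp (by fun_prop))).restrict
      (Eventually.of_forall fun s => (hbd _ _ _).trans (le_abs_self M))
  have hΦbd : ∀ Y t, ‖Real.exp (-(l * (max t t₀ - t₀))) • ∫ s in t₀..max t t₀, H Y s‖ ≤ M / l := by
    intro Y t
    have hu : 0 ≤ max t t₀ - t₀ := sub_nonneg.2 (le_max_right _ _)
    have h := intervalIntegral.norm_integral_le_of_norm_le_const (a := t₀) (b := max t t₀)
      (f := H Y) (C := M) fun s _ => hbd _ _ _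
    rw [abs_of_nonneg hu] at h
    rw [norm_smul, Real.norm_of_nonneg (Real.exp_pos _).le, Real.exp_neg,
      inv_mul_le_iff₀ (Real.exp_pos _)]
    refine h.trans ?_
    have hexp : l * (max t t₀ - t₀) ≤ Real.exp (l * (max t t₀ - t₀)) := by
      linarith [Real.add_one_le_exp (l * (max t t₀ - t₀))]
    rw [mul_div_assoc', le_div_iff₀ hl0]
    nlinarith
  let Φ : BoundedContinuousFunction ℝ E → BoundedContinuousFunction ℝ E := fun Y =>
    BoundedContinuousFunction.ofNormedAddCommGroup
      (fun t => Real.exp (-(l * (max t t₀ - t₀))) • ∫ s in t₀..max t t₀, H Y s)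
      (Continuous.smul (by fun_prop)
        ((intervalIntegral.continuous_primitive (hH Y) t₀).comp (by fun_prop)))
      (M / l) (hΦbd Y)
  have hcontr : ContractingWith (1 / 2) Φ := by
    refine ⟨by norm_num, LipschitzWith.of_dist_le_mul fun Y Z => ?_⟩
    have hD : 0 ≤ dist Y Z := dist_nonneg
    rw [BoundedContinuousFunction.dist_le (by positivity)]
    intro t
    have hPP : ∀ s, ‖P Y s - P Z s‖ ≤ Real.exp (l * (max s t₀ - t₀)) * dist Y Z := by
      intro s
      simp only [P, add_sub_add_left_eq_sub, ← smul_sub, norm_smul,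
        Real.norm_of_nonneg (Real.exp_pos _).le]
      gcongr
      rw [← dist_eq_norm]
      exact BoundedContinuousFunction.dist_coe_le_dist s
    have hint : ‖∫ s in t₀..max t t₀, (H Y s - H Z s)‖ ≤
        2 * L * dist Y Z / l * Real.exp (l * (max t t₀ - t₀)) := by
      refine norm_integral_le_of_norm_le_exp (le_max_right _ _) (by positivity) hl0 fun s hs => ?_
      have h₁ := hPP s
      have h₂ := hPP (s - δ)
      rw [max_eq_left hs.1.le] at h₁
      have h₃ : Real.exp (l * (max (s - δ) t₀ - t₀)) ≤ Real.exp (l * (s - t₀)) := by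
        gcongr
        exact max_le (by linarith) hs.1.le
      calc ‖H Y s - H Z s‖ ≤ L * (‖P Y s - P Z s‖ + ‖P Y (s - δ) - P Z (s - δ)‖) := hlip _ _ _ _ _
        _ ≤ L * (Real.exp (l * (s - t₀)) * dist Y Z + Real.exp (l * (s - t₀)) * dist Y Z) := by
          gcongr
          exact h₂.trans (by gcongr)
        _ = _ := by ring
    rw [intervalIntegral.integral_sub (hH Y _ _) (hH Z _ _)] at hint
    rw [dist_eq_norm]
    change ‖Real.exp (-(l * (max t t₀ - t₀))) • (∫ s in t₀..max t t₀, H Y s) -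
      Real.exp (-(l * (max t t₀ - t₀))) • ∫ s in t₀..max t t₀, H Z s‖ ≤ _
    rw [← smul_sub, norm_smul, Real.norm_of_nonneg (Real.exp_pos _).le, Real.exp_neg,
      inv_mul_le_iff₀ (Real.exp_pos _)]
    refine hint.trans ?_
    rw [mul_comm]
    gcongr
    rw [div_le_iff₀ hl0]
    push_cast
    nlinarith
  obtain ⟨Y, hY⟩ : ∃ Y, Φ Y = Y := ⟨_, hcontr.fixedPoint_isFixedPt⟩
  have hYt : ∀ t, Real.exp (l * (max t t₀ - t₀)) • Y t = ∫ s in t₀..max t t₀, H Y s := by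
    intro t
    have h : Real.exp (-(l * (max t t₀ - t₀))) • ∫ s in t₀..max t t₀, H Y s = Y t :=
      DFunLike.congr_fun hY t
    rw [← h, smul_smul, ← Real.exp_add, add_neg_cancel, Real.exp_zero, one_smul]
  refine ⟨P Y, hP Y, fun t ht => ?_, fun t ht => ?_⟩
  · change ξ (min t t₀) + _ = _
    rw [hYt, max_eq_right ht, min_eq_left ht, intervalIntegral.integral_same, add_zero]
  · change ξ (min t t₀) + _ = _
    rw [hYt, max_eq_left ht, min_eq_right ht]

end Integral

/-! ### Comparison functions and compactness margins -/

section Comparison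

theorem ClassKInf.surjective {α : ℝ≥0 → ℝ≥0} (hα : ClassKInf α) : Function.Surjective α := by
  intro y
  obtain ⟨_, ⟨b, rfl⟩, hb⟩ := not_bddAbove_iff.1 hα.unbounded y
  obtain ⟨x, -, hx⟩ := intermediate_value_Icc (zero_le : (0 : ℝ≥0) ≤ b)
    hα.classG.continuous.continuousOn ⟨by rw [hα.classG.map_zero]; exact zero_le, hb.le⟩
  exact ⟨x, hx⟩

theorem ClassKInf.apply_invFun {α : ℝ≥0 → ℝ≥0} (hα : ClassKInf α) (y : ℝ≥0) :
    α (Function.invFun α y) = y :=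
  Function.invFun_eq (hα.surjective y)

theorem ClassKInf.invFun {α : ℝ≥0 → ℝ≥0} (hα : ClassKInf α) : ClassKInf (Function.invFun α) := by
  have hleft : Function.LeftInverse (Function.invFun α) α :=
    Function.leftInverse_invFun hα.strictMono.injective
  have hmono : StrictMono (Function.invFun α) := fun a b hab => by
    rwa [← hα.strictMono.lt_iff_lt, hα.apply_invFun, hα.apply_invFun]
  refine ⟨⟨hmono.monotone.continuous_of_surjective hleft.surjective, ?_, hmono.monotone⟩, hmono, ?_⟩
  · simpa only [hα.classG.map_zero] using hleft 0
  · rw [hleft.surjective.range_eq]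
    exact not_bddAbove_univ

theorem ClassKInf.comp {α β : ℝ≥0 → ℝ≥0} (hα : ClassKInf α) (hβ : ClassKInf β) :
    ClassKInf (α ∘ β) := by
  refine ⟨⟨hα.classG.continuous.comp hβ.classG.continuous, ?_,
    hα.classG.monotone.comp hβ.classG.monotone⟩, hα.strictMono.comp hβ.strictMono, ?_⟩
  · simp [hβ.classG.map_zero, hα.classG.map_zero]
  · rw [(hα.surjective.comp hβ.surjective).range_eq]
    exact not_bddAbove_univ

theorem ClassG.comp {α β : ℝ≥0 → ℝ≥0} (hα : ClassG α) (hβ : ClassG β) : ClassG (α ∘ β) :=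
  ⟨hα.continuous.comp hβ.continuous, by simp [hβ.map_zero, hα.map_zero],
    hα.monotone.comp hβ.monotone⟩

/-- A strictly increasing continuous function grows by a uniform amount over steps of fixed
length starting in a bounded interval. -/
theorem exists_add_le_apply_add {g : ℝ≥0 → ℝ≥0} (hg : Continuous g) (hmono : StrictMono g)
    {σ : ℝ≥0} (hσ : 0 < σ) (B : ℝ≥0) :
    ∃ κ : ℝ≥0, 0 < κ ∧ ∀ u ≤ B, g u + κ ≤ g (u + σ) := by
  have hcont : Continuous fun u : ℝ≥0 => (g (u + σ) : ℝ) - g u :=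
    (NNReal.continuous_coe.comp (hg.comp (by fun_prop))).sub (NNReal.continuous_coe.comp hg)
  obtain ⟨κ, hκ, h⟩ := (isCompact_Icc (a := (0 : ℝ≥0)) (b := B)).exists_forall_le'
    hcont.continuousOn (a := 0) fun u _ =>
      sub_pos.2 (NNReal.coe_lt_coe.2 (hmono (lt_add_of_pos_right u hσ)))
  refine ⟨κ.toNNReal, Real.toNNReal_pos.2 hκ, fun u hu => ?_⟩
  rw [← NNReal.coe_le_coe, NNReal.coe_add, Real.coe_toNNReal _ hκ.le]
  linarith [h u ⟨zero_le, hu⟩]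

/-- A strict decrease estimate on the diagonal `y = x` over the region `γ(|w|) ≤ d(x)` persists,
on bounded sets, near the diagonal and over a slightly larger region. -/
theorem exists_decrease_margin {E W : Type*} [NormedAddCommGroup E] [ProperSpace E]
    [NormedAddCommGroup W] [ProperSpace W] {q : E × E × W → ℝ} (hq : Continuous q)
    {d : E → ℝ≥0} (hd : Continuous d) {γ : ℝ≥0 → ℝ≥0} (hγ : Continuous γ) {ρ : ℝ≥0} {a : ℝ}
    (ha : 0 < a) (hdec : ∀ x w, γ ‖w‖₊ ≤ d x → ρ ≤ d x → q (x, x, w) ≤ -a) (R B : ℝ) :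
    ∃ σ : ℝ≥0, 0 < σ ∧ ∀ x y w, ‖x‖ ≤ R → ‖y‖ ≤ R → ‖w‖ ≤ B → ρ ≤ d x → ‖x - y‖ ≤ σ →
      γ ‖w‖₊ ≤ d x + σ → q (x, y, w) ≤ -(a / 2) := by
  -- `K` collects the points where the halved decrease is not strict. There `‖x - y‖` and `γ(|w|) -
  -- d x` cannot both be nonpositive, so their maximum is bounded below by a positive constant.
  let K : Set (E × E × W) :=
    (Metric.closedBall 0 R ×ˢ Metric.closedBall 0 R ×ˢ Metric.closedBall 0 B) ∩
      {p | ρ ≤ d p.1 ∧ -(a / 2) ≤ q p}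
  have hK : IsCompact K :=
    ((isCompact_closedBall _ _).prod ((isCompact_closedBall _ _).prod
      (isCompact_closedBall _ _))).inter_right
      ((isClosed_le continuous_const (hd.comp continuous_fst)).inter
        (isClosed_le continuous_const hq))
  have hcont : Continuous fun p : E × E × W =>
      max ‖p.1 - p.2.1‖ ((γ ‖p.2.2‖₊ : ℝ) - d p.1) := by
    have h₁ : Continuous fun p : E × E × W => γ ‖p.2.2‖₊ := hγ.comp (by fun_prop)
    have h₂ : Continuous fun p : E × E × W => d p.1 := hd.comp (by fun_prop)
    fun_prop
  obtain ⟨σ, hσ, h⟩ := hK.exists_forall_le' hcont.continuousOn (a := 0) (by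
    rintro ⟨x, y, w⟩ ⟨-, hρ, hqa⟩
    by_contra! hle
    obtain ⟨hxy, hγd⟩ := max_le_iff.1 hle
    obtain rfl : x = y := sub_eq_zero.1 (norm_le_zero_iff.1 hxy)
    have := hdec x w (by exact_mod_cast sub_nonpos.1 hγd) hρ
    change -(a / 2) ≤ q (x, x, w) at hqa
    linarith)
  have hcoe : ((σ / 2).toNNReal : ℝ) = σ / 2 := Real.coe_toNNReal _ (half_pos hσ).le
  refine ⟨(σ / 2).toNNReal, Real.toNNReal_pos.2 (half_pos hσ),
    fun x y w hx hy hw hρ hxy hγd => ?_⟩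
  by_contra! hlt
  have hmem : (x, y, w) ∈ K := ⟨⟨by simpa using hx, by simpa using hy, by simpa using hw⟩,
    hρ, hlt.le⟩
  have hγd' : (γ ‖w‖₊ : ℝ) ≤ d x + σ / 2 := by rw [← hcoe]; exact_mod_cast hγd
  have hxy' : ‖x - y‖ ≤ σ / 2 := hxy.trans_eq hcoe
  have := (h _ hmem).trans (max_le hxy' (by simp only; linarith))
  linarith

end Comparison

/-! ### Barrier estimates with right derivatives -/

section Barrier

variable {v v' : ℝ → ℝ} {t₁ l : ℝ}

theorem le_of_deriv_right_neg (hv : ContinuousOn v (Ici t₁))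
    (hv' : ∀ t, t₁ ≤ t → HasDerivWithinAt v (v' t) (Ici t) t) (h₁ : v t₁ ≤ l)
    (hneg : ∀ t, t₁ ≤ t → v t = l → v' t < 0) : ∀ t, t₁ ≤ t → v t ≤ l := fun _ ht =>
  image_le_of_deriv_right_lt_deriv_boundary' (B := fun _ => l) (B' := fun _ => 0)
    (hv.mono Icc_subset_Ici_self) (fun s hs => hv' s hs.1) h₁ continuousOn_const
    (fun s _ => hasDerivWithinAt_const s (Ici s) l) (fun s hs => hneg s hs.1) ⟨ht, le_rfl⟩

/-- Either `v` has already reached `l` and is trapped below it, or it has decreased at rate `c` all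
along and by time `B / c` is at most `0 ≤ l`. -/
theorem le_of_deriv_right_le_neg {c B : ℝ} (hc : 0 < c) (hl : 0 ≤ l)
    (hv : ContinuousOn v (Ici t₁))
    (hv' : ∀ t, t₁ ≤ t → HasDerivWithinAt v (v' t) (Ici t) t) (h₁ : v t₁ ≤ B)
    (hneg : ∀ t, t₁ ≤ t → l ≤ v t → v' t ≤ -c) : ∀ t, t₁ + B / c ≤ t → t₁ ≤ t → v t ≤ l := by
  intro t hBt ht
  by_cases hs : ∃ s ∈ Icc t₁ t, v s ≤ l
  · obtain ⟨s, hs, hsl⟩ := hs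
    exact le_of_deriv_right_neg (hv.mono (Ici_subset_Ici.2 hs.1))
      (fun u hu => hv' u (hs.1.trans hu)) hsl
      (fun u hu hul => (hneg u (hs.1.trans hu) hul.ge).trans_lt (neg_lt_zero.2 hc)) t hs.2
  · push Not at hs
    have h := image_le_of_deriv_right_le_deriv_boundary (f := v) (f' := v') (a := t₁) (b := t)
      (B := fun s => B + -c * (s - t₁)) (B' := fun _ => -c)
      (hv.mono Icc_subset_Ici_self) (fun s hs => hv' s hs.1) (by simpa using h₁)
      (by fun_prop) (fun s _ => by
        simpa using ((((hasDerivAt_id s).sub_const t₁).const_mul (-c)).const_add B).hasDerivWithinAt)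
      (fun s hs' => hneg s hs'.1 (hs s ⟨hs'.1, hs'.2.le⟩).le) (x := t) ⟨ht, le_rfl⟩
    have hB : B ≤ c * (t - t₁) := by
      rw [← div_le_iff₀' hc]; linarith
    linarith

end Barrier

/-! ### Signals, segments and one-sided derivatives -/

section Signals

variable {E W : Type*} [NormedAddCommGroup E] [NormedAddCommGroup W]

theorem PiecewiseContinuousFrom.aestronglyMeasurable {w : ℝ → W} {a : ℝ}
    (hw : PiecewiseContinuousFrom w a) : AEStronglyMeasurable w (volume.restrict (Ici a)) := by
  let D : Set ℝ := ⋃ n : ℕ, {t ∈ Icc a n | ¬ ContinuousWithinAt w (Ici a) t}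
  have hD : D.Countable := countable_iUnion fun n => (hw.finite n).countable
  have hcont : ContinuousOn w (Ici a \ D) := by
    intro t ht
    by_contra hn
    obtain ⟨n, hn'⟩ := exists_nat_ge t
    exact ht.2 (mem_iUnion.2 ⟨n, ⟨ht.1, hn'⟩, fun h => hn (h.mono sdiff_subset)⟩)
  have hmeas := hcont.aestronglyMeasurable (μ := volume) (measurableSet_Ici.diff hD.measurableSet)
  rwa [Measure.restrict_congr_set (sdiff_null_ae_eq_self (hD.measure_zero volume))] at hmeas

/-- Only a right limit of the integrand is required, so a right derivative exists even where the
disturbance jumps. -/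
theorem hasDerivWithinAt_of_eq_integral [NormedSpace ℝ E] [CompleteSpace E] {X D : ℝ → E}
    {t₀ t : ℝ} {y c : E}
    (hX : ∀ s, t₀ ≤ s → X s = y + ∫ u in t₀..s, D u) (ht : t₀ ≤ t)
    (hD : IntervalIntegrable D volume t₀ t)
    (hmeas : AEStronglyMeasurable D (volume.restrict (Ici t₀)))
    (hlim : Tendsto D (𝓝[>] t) (𝓝 c)) : HasDerivWithinAt X c (Ici t) t := by
  have hat : StronglyMeasurableAtFilter D (𝓝[>] t) volume :=
    ⟨Ioi t, self_mem_nhdsWithin, hmeas.mono_measure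
      (Measure.restrict_mono (Ioi_subset_Ici ht) le_rfl)⟩
  have h := intervalIntegral.integral_hasDerivWithinAt_of_tendsto_ae_right (s := Ici t) hD hat
    (hlim.mono_left inf_le_left)
  exact (h.const_add y).congr (fun s hs => hX s (ht.trans hs)) (hX t ht)

theorem seg_apply {X : Type*} [Zero X] {r : ℝ} (x : ℝ → X) (t : ℝ) {s : ℝ}
    (hs : s ∈ Icc (-r) 0) : seg r x t s = x (t + s) :=
  indicator_of_mem hs _

theorem exists_forall_dist_lt_of_segDist_lt {r : ℝ} {A : Set E} {φ : ℝ → E} {D : ℝ≥0}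
    (h : segDist r A φ < D) : ∃ a ∈ A, ∀ s ∈ Icc (-r) 0, dist a (φ s) < D := by
  simp only [segDist, iInf_lt_iff] at h
  obtain ⟨a, ha, hlt⟩ := h
  refine ⟨a, ha, fun s hs => ?_⟩
  have := (le_iSup₂ (f := fun s (_ : s ∈ Icc (-r) 0) => edist a (φ s)) s hs).trans_lt hlt
  rwa [edist_nndist, ENNReal.coe_lt_coe, ← NNReal.coe_lt_coe, coe_nndist] at this

theorem segDist_le {r : ℝ} {A : Set E} {φ : ℝ → E} {D : ℝ≥0} {a : E} (ha : a ∈ A)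
    (h : ∀ s ∈ Icc (-r) 0, dist a (φ s) ≤ D) : segDist r A φ ≤ D := by
  refine (iInf₂_le a ha).trans (iSup₂_le fun s hs => ?_)
  rw [edist_nndist, ENNReal.coe_le_coe, ← NNReal.coe_le_coe, coe_nndist]
  exact h s hs

theorem norm_le_of_supSegNorm {r : ℝ} (hr : 0 ≤ r) {w : ℝ → W} {t₀ : ℝ}
    (h : supSegNorm r w t₀ ≠ ⊤) {t : ℝ} (ht : t₀ ≤ t) :
    ‖w t‖ ≤ ((supSegNorm r w t₀).toNNReal : ℝ) := by
  have h₁ : ‖w (t + 0)‖ₑ ≤ supSegNorm r w t₀ :=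
    (le_iSup₂ (f := fun s (_ : s ∈ Icc (-r) 0) => ‖w (t + s)‖ₑ) 0 ⟨by linarith, le_rfl⟩).trans
      (le_iSup₂ (f := fun t (_ : t ∈ Ici t₀) => ⨆ s ∈ Icc (-r) 0, ‖w (t + s)‖ₑ) t ht)
  rw [add_zero, ← ENNReal.coe_toNNReal h, enorm_eq_nnnorm, ENNReal.coe_le_coe] at h₁
  exact_mod_cast h₁

theorem supSegDist_congr {r : ℝ} {A : Set E} {x y : ℝ → E} {t₁ : ℝ}
    (h : ∀ t, t₁ - r ≤ t → x t = y t) : supSegDist r A x t₁ = supSegDist r A y t₁ := by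
  refine biSup_congr fun t ht => biInf_congr fun a _ => biSup_congr fun s hs => ?_
  rw [seg_apply x t hs, seg_apply y t hs, h _ (by linarith [mem_Ici.1 ht, hs.1])]

theorem closedLoop_seg {U : Type*} {f : E → U → W → E} {k : E → U} {r δ : ℝ}
    (hδ : 0 ≤ δ) (hδr : δ ≤ r)
    (x : ℝ → E) (w : ℝ → W) (s : ℝ) :
    closedLoop f k δ s (seg r x s) (seg r w s) = f (x s) (k (x (s - δ))) (w s) := by
  rw [closedLoop, seg_apply x s ⟨by linarith, le_rfl⟩, seg_apply w s ⟨by linarith, le_rfl⟩,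
    seg_apply x s ⟨by linarith, by linarith⟩, add_zero, sub_eq_add_neg]

end Signals

/-! ### Existence and uniqueness for the closed loop -/

section Solutions

variable {E W : Type*} [NormedAddCommGroup E] [NormedAddCommGroup W]
  [ProperSpace E] [ProperSpace W]

theorem exists_lipschitz_bound {h : E × E × W → E} (hh : LocallyLipschitz h) (R B : ℝ) :
    ∃ L : ℝ, 0 ≤ L ∧ ∀ x y x' y' w, ‖x‖ ≤ R → ‖y‖ ≤ R → ‖x'‖ ≤ R → ‖y'‖ ≤ R → ‖w‖ ≤ B →
      ‖h (x, y, w) - h (x', y', w)‖ ≤ L * (‖x - x'‖ + ‖y - y'‖) := by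
  obtain ⟨L, hL⟩ := (hh.locallyLipschitzOn
    (s := Metric.closedBall 0 R ×ˢ Metric.closedBall 0 R ×ˢ Metric.closedBall 0 B)
    ).exists_lipschitzOnWith_of_compact
      ((isCompact_closedBall _ _).prod ((isCompact_closedBall _ _).prod (isCompact_closedBall _ _)))
  refine ⟨L, L.2, fun x y x' y' w hx hy hx' hy' hw => ?_⟩
  have hd := hL.dist_le_mul (x, y, w) ⟨by simpa using hx, by simpa using hy, by simpa using hw⟩
    (x', y', w) ⟨by simpa using hx', by simpa using hy', by simpa using hw⟩
  rw [dist_eq_norm] at hd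
  refine hd.trans (mul_le_mul_of_nonneg_left ?_ L.2)
  rw [Prod.dist_eq, Prod.dist_eq, dist_self, dist_eq_norm, dist_eq_norm]
  exact max_le (le_add_of_nonneg_right (norm_nonneg _))
    (max_le (le_add_of_nonneg_left (norm_nonneg _)) (by positivity))

theorem exists_norm_bound {h : E × E × W → E} (hh : Continuous h) (R B : ℝ) :
    ∃ M : ℝ, 0 < M ∧ ∀ x y w, ‖x‖ ≤ R → ‖y‖ ≤ R → ‖w‖ ≤ B → ‖h (x, y, w)‖ ≤ M := by
  obtain ⟨M, hM⟩ := (((isCompact_closedBall (0 : E) R).prod ((isCompact_closedBall (0 : E) R).prod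
    (isCompact_closedBall (0 : W) B)))).exists_bound_of_continuousOn hh.continuousOn
  exact ⟨max M 1, by positivity, fun x y w hx hy hw => (hM (x, y, w)
    ⟨by simpa using hx, by simpa using hy, by simpa using hw⟩).trans (le_max_left _ _)⟩

variable [NormedSpace ℝ E]

/-- Global solution of the delayed equation whose state arguments are retracted to a ball. -/
theorem exists_retracted_solution {h : E × E × W → E} (hh : LocallyLipschitz h) {R M B δ r t₀ : ℝ}
    (hR : 0 < R) (hM : ∀ x y w, ‖x‖ ≤ R → ‖y‖ ≤ R → ‖w‖ ≤ B → ‖h (x, y, w)‖ ≤ M) (hδ : 0 ≤ δ)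
    (hr : 0 ≤ r) (ht₀ : 0 < t₀) {w : ℝ → W} (hw : IsDisturbance r w)
    (hwB : ∀ t, t₀ ≤ t → ‖w t‖ ≤ B) {ξ : ℝ → E} (hξ : ContinuousOn ξ (Icc (-r) 0)) :
    ∃ X : ℝ → E, Continuous X ∧ (∀ s ∈ Icc (-r) 0, X (t₀ + s) = ξ s) ∧
      (∀ t, t₀ ≤ t → IntervalIntegrable
        (fun s => h (ballRetract R (X s), ballRetract R (X (s - δ)), w s)) volume t₀ t) ∧
      (∀ t, t₀ ≤ t → X t = X t₀ +
        ∫ s in t₀..t, h (ballRetract R (X s), ballRetract R (X (s - δ)), w s)) ∧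
      (∀ t, t₀ ≤ t → ∃ v, ‖v‖ ≤ B ∧ HasDerivWithinAt X
        (h (ballRetract R (X t), ballRetract R (X (t - δ)), v)) (Ici t) t) ∧
      ∀ s t, t₀ ≤ s → s ≤ t → ‖X t - X s‖ ≤ M * (t - s) := by
  have hB : 0 ≤ B := (norm_nonneg _).trans (hwB t₀ le_rfl)
  obtain ⟨L, hL, hLip⟩ := exists_lipschitz_bound hh R B
  have hπ : Continuous (ballRetract R : E → E) := continuous_ballRetract hR
  have hπR : ∀ x : E, ‖ballRetract R x‖ ≤ R := norm_ballRetract_le hR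
  -- The bound on `w` is known only from `t₀` on; cutting off makes it global.
  let u : ℝ → W := (Ici t₀).indicator w
  have huw : ∀ t, t₀ ≤ t → u t = w t := fun t ht => indicator_of_mem (mem_Ici.2 ht) _
  have huB : ∀ t, ‖u t‖ ≤ B := by
    intro t
    by_cases ht : t₀ ≤ t
    · rw [huw t ht]; exact hwB t ht
    · rwa [show u t = 0 from indicator_of_notMem (by simpa using ht) _, norm_zero]
  have hu : AEStronglyMeasurable u volume :=
    (aestronglyMeasurable_indicator_iff measurableSet_Ici).2
      (hw.piecewise.aestronglyMeasurable.mono_measure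
        (Measure.restrict_mono (Ici_subset_Ici.2 (by linarith)) le_rfl))
  have hmeas : ∀ X Z : ℝ → E, Continuous X → Continuous Z → AEStronglyMeasurable
      (fun s => h (ballRetract R (X s), ballRetract R (Z s), u s)) volume := fun X Z hX hZ =>
    hh.continuous.comp_aestronglyMeasurable
      ((hπ.comp hX).aestronglyMeasurable.prodMk ((hπ.comp hZ).aestronglyMeasurable.prodMk hu))
  have hξc : Continuous fun t : ℝ => IccExtend (by linarith : -r ≤ 0) (domRestrict (Icc (-r) 0) ξ)
      (t - t₀) :=
    (continuousOn_iff_continuous_domRestrict.1 hξ).Icc_extend'.comp (by fun_prop)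
  obtain ⟨X, hX, hX₀, hXt⟩ := exists_delay_integral_solution
    (G := fun s x y => h (ballRetract R x, ballRetract R y, u s)) (L := 2 * L) (t₀ := t₀)
    (by positivity) hδ hmeas (fun s x y => hM _ _ _ (hπR x) (hπR y) (huB s))
    (fun s x y x' y' => (hLip _ _ _ _ _ (hπR _) (hπR _) (hπR _) (hπR _) (huB s)).trans (by
      rw [mul_comm 2 L, mul_assoc]
      refine mul_le_mul_of_nonneg_left ?_ hL
      linarith [norm_ballRetract_sub_le hR x x', norm_ballRetract_sub_le hR y y'])) hξc
  let D : ℝ → E := fun s => h (ballRetract R (X s), ballRetract R (X (s - δ)), u s)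
  have hDm : AEStronglyMeasurable D volume := hmeas X _ hX (hX.comp (by fun_prop))
  have hDM : ∀ s, ‖D s‖ ≤ M := fun s => hM _ _ _ (hπR _) (hπR _) (huB s)
  have hDi : ∀ a b, IntervalIntegrable D volume a b := fun a b =>
    (intervalIntegrable_const (c := M)).mono_fun hDm.restrict
      (Eventually.of_forall fun s => (hDM s).trans (le_abs_self M))
  have hDw : ∀ s, t₀ ≤ s → D s = h (ballRetract R (X s), ballRetract R (X (s - δ)), w s) :=
    fun s hs => by simp only [D, huw s hs]
  have hXt' : ∀ t, t₀ ≤ t → X t = X t₀ + ∫ s in t₀..t, D s := fun t ht => by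
    rw [hXt t ht, hX₀ t₀ le_rfl]
  refine ⟨X, hX, fun s hs => ?_, fun t ht => ?_, fun t ht => ?_, fun t ht => ?_,
    fun s t hs hst => ?_⟩
  · rw [hX₀ _ (by linarith [hs.2]), add_sub_cancel_left, IccExtend_of_mem _ _ hs, domRestrict_apply]
  · refine (hDi t₀ t).congr fun s hs => hDw s ?_
    rw [uIoc_of_le ht] at hs
    exact hs.1.le
  · rw [hXt' t ht]
    congr 1
    refine intervalIntegral.integral_congr fun s hs => hDw s ?_
    rw [uIcc_of_le ht] at hs
    exact hs.1
  -- The right derivative sees the right limit of `w`, which may differ from `w t` but obeys the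
  -- same bound.
  · obtain ⟨v, hv⟩ := hw.piecewise.right_lim t (by linarith)
    refine ⟨v, le_of_tendsto hv.norm (eventually_nhdsWithin_of_forall fun s hs =>
      hwB s (ht.trans (le_of_lt hs))), hasDerivWithinAt_of_eq_integral hXt' ht (hDi _ _)
      hDm.restrict ?_⟩
    have huv : Tendsto u (𝓝[>] t) (𝓝 v) :=
      hv.congr' (eventually_nhdsWithin_of_forall fun s hs => (huw s (ht.trans (le_of_lt hs))).symm)
    have h₁ : Tendsto (fun s => ballRetract R (X s)) (𝓝[>] t) (𝓝 (ballRetract R (X t))) :=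
      ((hπ.comp hX).tendsto t).mono_left nhdsWithin_le_nhds
    have h₂ : Tendsto (fun s => ballRetract R (X (s - δ))) (𝓝[>] t)
        (𝓝 (ballRetract R (X (t - δ)))) :=
      ((hπ.comp (hX.comp (continuous_sub_right δ))).tendsto t).mono_left nhdsWithin_le_nhds
    exact (hh.continuous.tendsto _).comp (h₁.prodMk_nhds (h₂.prodMk_nhds huv))
  · rw [hXt' t (hs.trans hst), hXt' s hs, add_sub_add_left_eq_sub,
      intervalIntegral.integral_interval_sub_left (hDi _ _) (hDi _ _)]
    have := intervalIntegral.norm_integral_le_of_norm_le_const (a := s) (b := t) (f := D)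
      (C := M) fun s _ => hDM s
    rwa [abs_of_nonneg (sub_nonneg.2 hst)] at this

variable {U : Type*} {f : E → U → W → E} {k : E → U}

/-- Up to time `t` both solutions stay in one ball, where the right-hand side is Lipschitz;
`eq_zero_of_delay_integral` then applies to their difference. -/
theorem IsSolution.eq_of_global {r δ t₀ B : ℝ} {w : ℝ → W} {ξ x X : ℝ → E} {T : ℝ≥0∞}
    (hh : LocallyLipschitz fun p : E × E × W => f p.1 (k p.2.1) p.2.2)
    (hδ : 0 ≤ δ) (hδr : δ ≤ r) (hw : ∀ t, t₀ ≤ t → ‖w t‖ ≤ B)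
    (hx : IsSolution r (closedLoop f k δ) w t₀ ξ T x)
    (hX : IsSolution r (closedLoop f k δ) w t₀ ξ ⊤ X) {t : ℝ} (ht : t₀ ≤ t)
    (htT : ENNReal.ofReal (t - t₀) < T) : x t = X t := by
  have hxc : ContinuousOn x (Icc (t₀ - r) t) := hx.continuousOn.mono fun s hs =>
    ⟨hs.1, (ENNReal.ofReal_le_ofReal (by linarith [hs.2])).trans_lt htT⟩
  have hXc : ContinuousOn X (Icc (t₀ - r) t) := hX.continuousOn.mono fun s hs =>
    ⟨hs.1, ENNReal.ofReal_lt_top⟩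
  obtain ⟨R₁, hR₁⟩ := isCompact_Icc.exists_bound_of_continuousOn hxc
  obtain ⟨R₂, hR₂⟩ := isCompact_Icc.exists_bound_of_continuousOn hXc
  obtain ⟨L, hL, hLip⟩ := exists_lipschitz_bound hh (max R₁ R₂) B
  have hsT : ∀ s, s ≤ t → ENNReal.ofReal (s - t₀) < T := fun s hs =>
    (ENNReal.ofReal_le_ofReal (by linarith)).trans_lt htT
  have hsub : Icc t₀ t ⊆ Icc (t₀ - r) t := Icc_subset_Icc_left (by linarith)
  have hinit : ∀ s ∈ Icc (t₀ - r) t₀, x s = X s := fun s hs => by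
    have h₁ := hx.init (s - t₀) ⟨by linarith [hs.1], by linarith [hs.2]⟩
    have h₂ := hX.init (s - t₀) ⟨by linarith [hs.1], by linarith [hs.2]⟩
    rw [add_sub_cancel] at h₁ h₂
    rw [h₁, h₂]
  refine sub_eq_zero.1 (eq_zero_of_delay_integral (z := fun s => x s - X s)
    (D := fun s => f (x s) (k (x (s - δ))) (w s) - f (X s) (k (X (s - δ))) (w s)) hL hδ
    ((hxc.sub hXc).mono hsub) (fun s hs => sub_eq_zero.2 (hinit s ⟨by linarith [hs.1], hs.2⟩))
    (fun s hs => ?_) (fun s hs => ?_) t ⟨ht, le_rfl⟩)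
  · have i₁ := hx.integrable s hs.1 (hsT s hs.2)
    have i₂ := hX.integrable s hs.1 ENNReal.ofReal_lt_top
    have e₁ := hx.eqn s hs.1 (hsT s hs.2)
    have e₂ := hX.eqn s hs.1 ENNReal.ofReal_lt_top
    simp only [closedLoop_seg hδ hδr] at i₁ i₂ e₁ e₂
    rw [intervalIntegral.integral_sub i₁ i₂, e₁, e₂, hinit t₀ ⟨by linarith, le_rfl⟩,
      add_sub_add_left_eq_sub]
  · have hs' : s - δ ∈ Icc (t₀ - r) t := ⟨by linarith [hs.1], by linarith [hs.2]⟩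
    exact hLip _ _ _ _ _ ((hR₁ s (hsub hs)).trans (le_max_left _ _))
      ((hR₁ _ hs').trans (le_max_left _ _)) ((hR₂ s (hsub hs)).trans (le_max_right _ _))
      ((hR₂ _ hs').trans (le_max_right _ _)) (hw s hs.1)

/-- Since solutions are unique, uniform ISS follows from estimates on one global solution for each
choice of admissible data. -/
theorem uniformlyISS_of_global_solution {r δ τ : ℝ} {A : Set E} {γt : ℝ≥0 → ℝ≥0} {μ d : ℝ≥0}
    {Δx Δw : ℝ≥0∞}
    (hh : LocallyLipschitz fun p : E × E × W => f p.1 (k p.2.1) p.2.2)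
    (hδ : 0 ≤ δ) (hδr : δ ≤ r) (hγt : ClassG γt) (hd : 0 < d) (hτ : 0 < τ)
    (hsol : ∀ w t₀ ξ, IsAdmissible r A Δx Δw w t₀ ξ → ∃ X,
      IsSolution r (closedLoop f k δ) w t₀ ξ ⊤ X ∧
      (segDist r A ξ ≤ d →
        supSegDist r A X t₀ ≤ (max (γt (supSegNorm r w t₀).toNNReal) μ : ℝ≥0)) ∧
      supSegDist r A X (t₀ + τ) ≤ (max (γt (supSegNorm r w t₀).toNNReal) μ : ℝ≥0)) :
    UniformlyISS r (closedLoop f k δ) A γt μ Δx Δw := by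
  have hmax : ∀ w t₀ ξ T x X, IsAdmissible r A Δx Δw w t₀ ξ →
      IsSolution r (closedLoop f k δ) w t₀ ξ ⊤ X →
      IsMaximalSolution r (closedLoop f k δ) w t₀ ξ T x →
      T = ⊤ ∧ ∀ t, t₀ - r ≤ t → x t = X t := by
    intro w t₀ ξ T x X had hX hx
    have heq : ∀ t, t₀ ≤ t → ENNReal.ofReal (t - t₀) < T → x t = X t := fun t ht htT =>
      hx.1.eq_of_global hh hδ hδr
        (fun s hs => norm_le_of_supSegNorm (hδ.trans hδr) had.dist_lt.ne_top hs) hX ht htT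
    have hT : T = ⊤ := (hx.2 ⊤ X hX le_top fun t ht htT => (heq t ht htT).symm).symm
    refine ⟨hT, fun t ht => ?_⟩
    rcases le_total t₀ t with h | h
    · exact heq t h (hT ▸ ENNReal.ofReal_lt_top)
    · have h₁ := hx.1.init (t - t₀) ⟨by linarith, by linarith⟩
      have h₂ := hX.init (t - t₀) ⟨by linarith, by linarith⟩
      rw [add_sub_cancel] at h₁ h₂
      rw [h₁, h₂]
  -- The positive offset makes `ε` superfluous: one `d` and one `τ` serve all `ε`, `ηx`, `ηw`.
  refine ⟨hγt, fun w t₀ ξ had => ?_, fun w t₀ ξ had T x hx => ?_, fun ε _ => ⟨d, hd, ?_⟩,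
    fun ε ηx ηw _ _ _ _ _ => ⟨τ, hτ, ?_⟩⟩
  · obtain ⟨X, hX, -⟩ := hsol w t₀ ξ had
    exact ⟨⊤, X, hX, fun T' x' _ hT' _ => top_le_iff.1 hT'⟩
  · obtain ⟨X, hX, -⟩ := hsol w t₀ ξ had
    exact (hmax w t₀ ξ T x X had hX hx).1
  · intro w t₀ ξ had hξ T x hx
    obtain ⟨X, hX, hXs, -⟩ := hsol w t₀ ξ had
    rw [supSegDist_congr (hmax w t₀ ξ T x X had hX hx).2]
    exact (hXs hξ).trans (ENNReal.coe_le_coe.2 (le_max_right _ _))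
  · intro w t₀ ξ had _ _ T x hx
    obtain ⟨X, hX, -, hXτ⟩ := hsol w t₀ ξ had
    rw [supSegDist_congr fun t ht => (hmax w t₀ ξ T x X had hX hx).2 t (by linarith)]
    exact hXτ.trans (ENNReal.coe_le_coe.2 (le_max_right _ _))

end Solutions

/-! ### Uniform ISS for small delays -/

section Main

theorem locallyLipschitz_feedback {E U W : Type*} [PseudoEMetricSpace E] [PseudoEMetricSpace U]
    [PseudoEMetricSpace W] {f : E → U → W → E} {k : E → U}
    (hf : LocallyLipschitz fun p : E × U × W => f p.1 p.2.1 p.2.2) (hk : LocallyLipschitz k) :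
    LocallyLipschitz fun p : E × E × W => f p.1 (k p.2.1) p.2.2 := by
  have hfst : LocallyLipschitz (Prod.fst : E × E × W → E) := LipschitzWith.prod_fst.locallyLipschitz
  have hsnd : LocallyLipschitz (Prod.snd : E × E × W → E × W) :=
    LipschitzWith.prod_snd.locallyLipschitz
  have hφ : LocallyLipschitz fun p : E × E × W => (p.1, k p.2.1, p.2.2) :=
    hfst.prodMk ((hk.comp (LipschitzWith.prod_fst.locallyLipschitz.comp hsnd)).prodMk
      (LipschitzWith.prod_snd.locallyLipschitz.comp hsnd))
  exact hf.comp hφ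

variable {E U W : Type*} [NormedAddCommGroup E] [NormedSpace ℝ E] [ProperSpace E]
  [NormedAddCommGroup W] [ProperSpace W] {f : E → U → W → E} {k : E → U}

theorem exists_delay_uniformlyISS
    (hh : LocallyLipschitz fun p : E × E × W => f p.1 (k p.2.1) p.2.2)
    {A : Set E} (hA : IsCompact A) (hAne : A.Nonempty) {α₁ α₂ α₃ γ : ℝ≥0 → ℝ≥0} {V : E → ℝ}
    (hα₁ : ClassKInf α₁) (hα₂ : ClassKInf α₂) (hα₃ : ClassKInf α₃) (hγ : ClassG γ)
    (hV : ContDiff ℝ 1 V)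
    (hVα : ∀ x, (α₁ (Metric.infNndist x A) : ℝ) ≤ V x ∧ V x ≤ α₂ (Metric.infNndist x A))
    (hdec : ∀ x w, γ ‖w‖₊ ≤ Metric.infNndist x A →
      fderiv ℝ V x (f x (k x) w) ≤ -(α₃ (Metric.infNndist x A) : ℝ))
    {μ Δx Δw : ℝ≥0} (hμ : 0 < μ) :
    ∃ δs : ℝ, 0 < δs ∧ ∀ δ ∈ Ioo 0 δs, ∀ r ∈ Icc δ (2 * δ),
      UniformlyISS r (closedLoop f k δ) A (Function.invFun α₁ ∘ α₂ ∘ γ) μ Δx Δw := by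
  set d : E → ℝ≥0 := fun x => Metric.infNndist x A with hd
  set g : ℝ≥0 → ℝ≥0 := Function.invFun α₁ ∘ α₂ with hg_def
  have hg : ClassKInf g := hα₁.invFun.comp hα₂
  have hd_le : ∀ x, ∀ a ∈ A, (d x : ℝ) ≤ dist a x := fun x a ha => by
    rw [dist_comm]; exact Metric.infDist_le_dist_of_mem ha
  have hd_eq : ∀ x, ∃ a ∈ A, (d x : ℝ) = dist a x := fun x => by
    obtain ⟨a, ha, h⟩ := hA.exists_infDist_eq_dist hAne x
    exact ⟨a, ha, by rw [dist_comm, ← h]; rfl⟩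
  have hd_add : ∀ x y, (d x : ℝ) ≤ d y + ‖x - y‖ := fun x y => by
    rw [← dist_eq_norm]; exact Metric.infDist_le_infDist_add_dist
  have hdV : ∀ {x b}, V x ≤ α₂ b → d x ≤ g b := fun {x b} h => by
    rw [← hα₁.strictMono.le_iff_le, hg_def, Function.comp_apply, hα₁.apply_invFun]
    exact_mod_cast (hVα x).1.trans h
  have hVd : ∀ {x b}, (α₂ b : ℝ) ≤ V x → b ≤ d x := fun {x b} h => by
    rw [← hα₂.strictMono.le_iff_le]
    exact_mod_cast h.trans (hVα x).2
  -- Half of the offset is for the sublevel set, the other half for the oscillation over a window.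
  obtain ⟨ρ, hρ⟩ := hg.surjective (μ / 2)
  have hρ0 : 0 < ρ := by
    rw [← hg.strictMono.lt_iff_lt, hρ, hg.classG.map_zero]; exact half_pos hμ
  -- `Δx + 1` bounds the distance to `A` after the first delay interval; the other terms ensure that
  -- the attracting level lies below `C`.
  set C : ℝ≥0 := max (Δx + 1) (max (γ Δw) ρ) with hC
  obtain ⟨CA, hCA⟩ := hA.isBounded.exists_norm_le
  have hCA0 : 0 ≤ CA := (norm_nonneg _).trans (hCA _ hAne.some_mem)
  set R : ℝ := CA + (g C + Δx + 1) with hR_def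
  have hR : 0 < R := by positivity
  have hdR : ∀ x, (d x : ℝ) ≤ g C + Δx + 1 → ‖x‖ ≤ R := fun x hx => by
    obtain ⟨a, ha, h⟩ := hd_eq x
    have h₁ : ‖x‖ ≤ ‖a‖ + ‖a - x‖ := by
      simpa using norm_sub_le a (a - x)
    rw [dist_eq_norm] at h
    linarith [hCA a ha]
  obtain ⟨M, hM0, hM⟩ := exists_norm_bound hh.continuous R Δw
  have hα₃ρ : 0 < (α₃ ρ : ℝ) := by
    exact_mod_cast (hα₃.classG.map_zero ▸ hα₃.strictMono hρ0 : 0 < α₃ ρ)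
  have hq : Continuous fun p : E × E × W => fderiv ℝ V p.1 (f p.1 (k p.2.1) p.2.2) :=
    ((hV.continuous_fderiv one_ne_zero).comp continuous_fst).clm_apply hh.continuous
  obtain ⟨σ, hσ, hmargin⟩ := exists_decrease_margin hq
    (Metric.continuous_infNndist_pt A) hγ.continuous (ρ := ρ) hα₃ρ
    (fun x w hw hρx => (hdec x w hw).trans
      (neg_le_neg (NNReal.coe_le_coe.2 (hα₃.strictMono.monotone hρx)))) R Δw
  obtain ⟨κ, hκ, hslack⟩ := exists_add_le_apply_add hg.classG.continuous hg.strictMono hσ (γ Δw)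
  set c : ℝ := α₃ ρ / 2 with hc
  have hc0 : 0 < c := half_pos hα₃ρ
  -- Bounds for `M * δ`: `1` keeps states in the ball, `σ` gives the decrease, `μ / 4` and `κ / 2`
  -- control `M * r ≤ 2 * (M * δ)`, and `ρ / 2` serves the stability estimate.
  set e : ℝ := min 1 (min σ (min (μ / 4) (min (κ / 2) (ρ / 2)))) with he
  have he0 : 0 < e := by
    have h₁ : (0 : ℝ) < σ := hσ
    have h₂ : (0 : ℝ) < κ := hκ
    have h₃ : (0 : ℝ) < ρ := hρ0
    have h₄ : (0 : ℝ) < μ := hμ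
    positivity
  refine ⟨e / M, by positivity, fun δ hδ r hr => ?_⟩
  have hδ0 : 0 < δ := hδ.1
  have hr0 : 0 < r := hδ0.trans_le hr.1
  have hMδ : M * δ ≤ e := by rw [← le_div_iff₀' hM0]; exact hδ.2.le
  obtain ⟨hMδ1, hMδσ, hMδμ, hMδκ, hMδρ⟩ :
      M * δ ≤ 1 ∧ M * δ ≤ σ ∧ M * δ ≤ μ / 4 ∧ M * δ ≤ κ / 2 ∧ M * δ ≤ ρ / 2 := by
    simpa only [he, le_min_iff] using hMδ
  have hMr : M * r ≤ 2 * (M * δ) := by nlinarith [hr.2]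
  set η : ℝ≥0 := min (μ / 8) (ρ / 8) with hη
  have hη0 : 0 < η := lt_min (by positivity) (by positivity)
  have hημ : (η : ℝ) ≤ μ / 8 := by exact_mod_cast min_le_left (μ / 8) (ρ / 8)
  have hηρ : (η : ℝ) ≤ ρ / 8 := by exact_mod_cast min_le_right (μ / 8) (ρ / 8)
  -- The time consists of one delay before the decrease is available, the descent of `V` from `α₂ C`
  -- at rate `c`, and one window length.
  refine uniformlyISS_of_global_solution (d := η) (τ := δ + α₂ C / c + r) hh hδ0.le hr.1
    ((hα₁.invFun.comp hα₂).classG.comp hγ) hη0 (by positivity) fun w t₀ ξ had => ?_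
  set b : ℝ≥0 := (supSegNorm r w t₀).toNNReal with hb
  have hwb : ∀ t, t₀ ≤ t → ‖w t‖ ≤ b := fun t =>
    norm_le_of_supSegNorm hr0.le had.dist_lt.ne_top
  have hbΔ : b ≤ Δw := by
    rw [← ENNReal.coe_le_coe, hb, ENNReal.coe_toNNReal had.dist_lt.ne_top]
    exact had.dist_lt.le
  have hγb : γ b ≤ γ Δw := hγ.monotone hbΔ
  obtain ⟨X, hX, hXξ, hXi, hXe, hXd, hXM⟩ := exists_retracted_solution hh hR
    (fun x y w hx hy hw => hM x y w hx hy (hw.trans (NNReal.coe_le_coe.2 hbΔ))) hδ0.le hr0.le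
    had.pos had.disturbance hwb had.continuousOn
  choose! u hub hu using hXd
  obtain ⟨a₀, ha₀, hξa₀⟩ := exists_forall_dist_lt_of_segDist_lt had.init_lt
  have hpast : ∀ t ∈ Icc (t₀ - r) t₀, (d (X t) : ℝ) ≤ Δx := fun t ht => by
    have h := hXξ (t - t₀) ⟨by linarith [ht.1], by linarith [ht.2]⟩
    rw [add_sub_cancel] at h
    rw [h]
    exact (hd_le _ a₀ ha₀).trans (hξa₀ _ ⟨by linarith [ht.1], by linarith [ht.2]⟩).le
  have hearly : ∀ t ∈ Icc t₀ (t₀ + δ), (d (X t) : ℝ) ≤ d (X t₀) + M * δ := fun t ht => by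
    have h₁ := hXM t₀ t le_rfl ht.1
    have h₂ : M * (t - t₀) ≤ M * δ := mul_le_mul_of_nonneg_left (by linarith [ht.2]) hM0.le
    linarith [hd_add (X t) (X t₀)]
  have hd₀ := hpast t₀ ⟨by linarith, le_rfl⟩
  -- The set `{V ≤ α₂ lvl}` is the sublevel set that attracts the trajectory.
  set lvl : ℝ≥0 := max (γ b - σ) ρ with hlvl
  have hlvlC : lvl ≤ C :=
    max_le ((tsub_le_self.trans hγb).trans ((le_max_left _ _).trans (le_max_right _ _)))
      ((le_max_right _ _).trans (le_max_right _ _))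
  let v' : ℝ → ℝ := fun t => fderiv ℝ V (X t)
    (f (ballRetract R (X t)) (k (ballRetract R (X (t - δ)))) (u t))
  have hvc : ContinuousOn (fun t => V (X t)) (Ici (t₀ + δ)) := (hV.continuous.comp hX).continuousOn
  have hv' : ∀ t, t₀ + δ ≤ t → HasDerivWithinAt (fun t => V (X t)) (v' t) (Ici t) t := fun t ht =>
    ((hV.differentiable one_ne_zero _).hasFDerivAt).comp_hasDerivWithinAt t
      (hu t (by linarith))
  -- From `t₀ + δ` on, the delayed time lies past the initial segment, whose oscillation is
  -- uncontrolled. The bound on `V` makes the retraction inert at both arguments.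
  have hneg : ∀ t, t₀ + δ ≤ t → V (X t) ≤ α₂ C → lvl ≤ d (X t) → v' t ≤ -c := by
    intro t ht hVt hlt
    have hdt : (d (X t) : ℝ) ≤ g C := NNReal.coe_le_coe.2 (hdV hVt)
    have hXX := hXM (t - δ) t (by linarith) (by linarith)
    rw [sub_sub_cancel] at hXX
    have h₁ : ‖X t‖ ≤ R := hdR _ (by linarith [Δx.coe_nonneg])
    have h₂ : ‖X (t - δ)‖ ≤ R := hdR _ (by
      have := hd_add (X (t - δ)) (X t)
      rw [norm_sub_rev] at this
      linarith [Δx.coe_nonneg])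
    simp only [v', ballRetract_eq_self hR h₁, ballRetract_eq_self hR h₂]
    have hut : ‖u t‖₊ ≤ b := hub t (by linarith)
    exact hmargin _ _ _ h₁ h₂ (NNReal.coe_le_coe.2 (hut.trans hbΔ)) ((le_max_right _ _).trans hlt)
      (hXX.trans hMδσ)
      ((hγ.monotone hut).trans (tsub_le_iff_right.1 ((le_max_left _ _).trans hlt)))
  have hd₁ := hearly (t₀ + δ) ⟨by linarith, le_rfl⟩
  have hV₁ : V (X (t₀ + δ)) ≤ α₂ C := (hVα _).2.trans (NNReal.coe_le_coe.2
    (hα₂.strictMono.monotone (le_trans (by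
      rw [← NNReal.coe_le_coe, NNReal.coe_add, NNReal.coe_one]
      change (d _ : ℝ) ≤ _
      linarith) (le_max_left (Δx + 1) _))))
  -- The bootstrap closes here: on the boundary `V = α₂ C` the conditional decrease applies, so the
  -- sublevel set is never left.
  have hVC : ∀ t, t₀ + δ ≤ t → V (X t) ≤ α₂ C :=
    le_of_deriv_right_neg hvc hv' hV₁ fun t ht hVt =>
      (hneg t ht hVt.le (hlvlC.trans (hVd hVt.ge))).trans_lt (neg_lt_zero.2 hc0)
  have hneg' : ∀ t, t₀ + δ ≤ t → (α₂ lvl : ℝ) ≤ V (X t) → v' t ≤ -c := fun t ht hVt =>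
    hneg t ht (hVC t ht) (hVd hVt)
  have hXR : ∀ t, t₀ - r ≤ t → ‖X t‖ ≤ R := fun t ht => hdR _ (by
    have hgC : (0 : ℝ) ≤ g C := (g C).coe_nonneg
    rcases le_total t t₀ with h | h
    · linarith [hpast t ⟨ht, h⟩]
    rcases le_total t (t₀ + δ) with h' | h'
    · linarith [hearly t ⟨h, h'⟩]
    · have : (d (X t) : ℝ) ≤ g C := NNReal.coe_le_coe.2 (hdV (hVC t h'))
      linarith [Δx.coe_nonneg])
  have hfX : ∀ s, t₀ ≤ s →
      f (ballRetract R (X s)) (k (ballRetract R (X (s - δ)))) (w s) =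
        closedLoop f k δ s (seg r X s) (seg r w s) := fun s hs => by
    rw [closedLoop_seg hδ0.le hr.1, ballRetract_eq_self hR (hXR s (by linarith)),
      ballRetract_eq_self hR (hXR (s - δ) (by linarith [hr.1]))]
  have hsol : IsSolution r (closedLoop f k δ) w t₀ ξ ⊤ X := by
    refine ⟨ENNReal.zero_lt_top, hXξ, hX.continuousOn, fun t ht _ => ?_, fun t ht _ => ?_⟩
    · refine (hXi t ht).congr fun s hs => hfX s ?_
      rw [uIoc_of_le ht] at hs
      exact hs.1.le
    · rw [hXe t ht]
      congr 1
      refine intervalIntegral.integral_congr fun s hs => hfX s ?_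
      rw [uIcc_of_le ht] at hs
      exact hs.1
  -- If `ρ` dominates, the offset absorbs the window error; otherwise the subtraction is not
  -- truncated and the slack `κ` does.
  have hroom : (g lvl : ℝ) + M * r ≤ (max (g (γ b)) μ : ℝ≥0) := by
    rw [NNReal.coe_max]
    rcases le_total (γ b - σ) ρ with h | h
    · refine le_max_of_le_right ?_
      rw [hlvl, max_eq_right h, hρ, NNReal.coe_div, NNReal.coe_ofNat]
      linarith
    · refine le_max_of_le_left ?_
      have h₁ := hslack (γ b - σ) (tsub_le_self.trans hγb)
      rw [tsub_add_cancel_of_le (tsub_pos_iff_lt.1 (hρ0.trans_le h)).le, ← NNReal.coe_le_coe,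
        NNReal.coe_add] at h₁
      rw [hlvl, max_eq_left h]
      linarith
  have hseg : ∀ t, t₀ + r ≤ t → V (X t) ≤ α₂ lvl →
      segDist r A (seg r X t) ≤ (max (g (γ b)) μ : ℝ≥0) := by
    intro t ht hVt
    obtain ⟨a, ha, hat⟩ := hd_eq (X t)
    -- The point of `A` nearest to `X t` serves the whole window, which lies after `t₀` and so has
    -- oscillation at most `M * r`.
    refine segDist_le ha fun s hs => ?_
    rw [seg_apply X t hs]
    have h₁ := hXM (t + s) t (by linarith [hs.1]) (by linarith [hs.2])
    have h₂ : M * (t - (t + s)) ≤ M * r := mul_le_mul_of_nonneg_left (by linarith [hs.1]) hM0.le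
    have h₃ : (d (X t) : ℝ) ≤ g lvl := NNReal.coe_le_coe.2 (hdV hVt)
    rw [← dist_eq_norm] at h₁
    linarith [dist_triangle a (X t) (X (t + s))]
  refine ⟨X, hsol, fun hξη => iSup₂_le fun t ht => ?_, iSup₂_le fun t ht => ?_⟩
  -- Passing from `η` to `2 * η` gives the strict inequality needed to pick one `a`, since the
  -- infimum is not shown to be attained.
  · obtain ⟨a, ha, hξa⟩ := exists_forall_dist_lt_of_segDist_lt
      (hξη.trans_lt (ENNReal.coe_lt_coe.2 (lt_mul_of_one_lt_left hη0 one_lt_two)))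
    rw [NNReal.coe_mul, NNReal.coe_ofNat] at hξa
    have hX₀ : X t₀ = ξ 0 := by simpa using hXξ 0 ⟨by linarith, le_rfl⟩
    have haX : dist a (X t₀) < 2 * η := hX₀ ▸ hξa 0 ⟨by linarith, le_rfl⟩
    rcases le_total (t₀ + r) t with h | h
    · refine hseg t h (le_of_deriv_right_neg hvc hv' ?_
        (fun t ht hVt => (hneg' t ht hVt.ge).trans_lt (neg_lt_zero.2 hc0)) t (by linarith [hr.1]))
      refine (hVα _).2.trans (NNReal.coe_le_coe.2 (hα₂.strictMono.monotone
        (le_trans ?_ (le_max_right _ ρ))))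
      rw [← NNReal.coe_le_coe]
      change (d _ : ℝ) ≤ _
      linarith [hd_le (X t₀) a ha]
    · refine segDist_le ha fun s hs => ?_
      rw [NNReal.coe_max]
      refine le_max_of_le_right ?_
      rw [seg_apply X t hs]
      rcases le_total (t + s) t₀ with h' | h'
      · have hmem : t + s - t₀ ∈ Icc (-r) 0 := ⟨by linarith [mem_Ici.1 ht, hs.1], by linarith⟩
        have h₁ := hXξ _ hmem
        rw [add_sub_cancel] at h₁
        rw [h₁]
        linarith [hξa _ hmem, μ.coe_nonneg]
      · have h₁ := hXM t₀ (t + s) le_rfl h'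
        have h₂ : M * (t + s - t₀) ≤ M * r :=
          mul_le_mul_of_nonneg_left (by linarith [hs.2]) hM0.le
        rw [norm_sub_rev, ← dist_eq_norm] at h₁
        linarith [dist_triangle a (X t₀) (X (t + s))]
  · have hαc : 0 ≤ (α₂ C : ℝ) / c := by positivity
    have ht' := mem_Ici.1 ht
    exact hseg t (by linarith) (le_of_deriv_right_le_neg hc0 (α₂ lvl).coe_nonneg hvc hv' hV₁ hneg'
      t (by linarith) (by linarith))

end Main

/-- A property that holds at each level `n` for all small parameters holds, for all small
parameters, at a level that tends to infinity as the parameter tends to zero. -/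
theorem exists_level_tendsto_atTop {P : ℕ → ℝ → Prop}
    (h : ∀ n, ∃ s : ℝ, 0 < s ∧ ∀ δ ∈ Ioo 0 s, P n δ) :
    ∃ s : ℝ, 0 < s ∧ ∃ N : ℝ → ℕ, (∀ δ ∈ Ioo 0 s, P (N δ) δ) ∧ Tendsto N (𝓝[>] 0) atTop := by
  classical
  choose s hs hP using h
  -- The cap `⌊δ⁻¹⌋₊` keeps the search finite, as `s n` need not tend to zero, yet itself tends to
  -- infinity as `δ → 0⁺`.
  refine ⟨s 0, hs 0, fun δ => Nat.findGreatest (fun n => δ < s n) ⌊δ⁻¹⌋₊, fun δ hδ => ?_, ?_⟩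
  · exact hP _ δ ⟨hδ.1, Nat.findGreatest_spec (P := fun n => δ < s n) (Nat.zero_le _) hδ.2⟩
  · refine tendsto_atTop.2 fun n => ?_
    have h₁ : ∀ᶠ δ in 𝓝[>] (0 : ℝ), δ < s n := nhdsWithin_le_nhds (Iio_mem_nhds (hs n))
    have h₂ : ∀ᶠ δ in 𝓝[>] (0 : ℝ), (n : ℝ) ≤ δ⁻¹ := tendsto_inv_nhdsGT_zero.eventually_ge_atTop _
    filter_upwards [h₁, h₂] with δ hδ hn
    exact Nat.le_findGreatest (Nat.le_floor hn) hδ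

end DelayISS

theorem mainTheorem3 (n c m : ℕ)
    (f : EuclideanSpace ℝ (Fin n) → EuclideanSpace ℝ (Fin c) → EuclideanSpace ℝ (Fin m) →
      EuclideanSpace ℝ (Fin n))
    (hf : LocallyLipschitz fun p : EuclideanSpace ℝ (Fin n) × EuclideanSpace ℝ (Fin c) ×
      EuclideanSpace ℝ (Fin m) => f p.1 p.2.1 p.2.2)
    (A : Set (EuclideanSpace ℝ (Fin n))) (hA : IsCompact A) (hA0 : 0 ∈ A)
    (k : EuclideanSpace ℝ (Fin n) → EuclideanSpace ℝ (Fin c)) (γt : ℝ≥0 → ℝ≥0)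
    (hstab : DelayISS.StabilizedWithGain f A k γt) :
    ∃ δs : ℝ, 0 < δs ∧ ∃ μ Δx Δw : ℝ → ℝ≥0,
      (∀ δ ∈ Ioo 0 δs, 0 < μ δ ∧ 0 < Δx δ ∧ 0 < Δw δ ∧
        ∀ r ∈ Icc δ (2 * δ),
          DelayISS.UniformlyISS r (DelayISS.closedLoop f k δ) A γt (μ δ) (Δx δ) (Δw δ)) ∧
      Tendsto μ (𝓝[>] 0) (𝓝 0) ∧ Tendsto Δx (𝓝[>] 0) atTop ∧ Tendsto Δw (𝓝[>] 0) atTop := by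
  obtain ⟨hk, α₁, α₂, α₃, γ, V, hα₁, hα₂, hα₃, hγ, hV, hVα, hdec, rfl⟩ := hstab
  have hh := DelayISS.locallyLipschitz_feedback hf (hk.of_le (mod_cast le_top)).locallyLipschitz
  obtain ⟨δs, hδs, N, hN, hNtop⟩ := DelayISS.exists_level_tendsto_atTop
    (P := fun j δ => ∀ r ∈ Icc δ (2 * δ), DelayISS.UniformlyISS r (DelayISS.closedLoop f k δ) A
      (Function.invFun α₁ ∘ α₂ ∘ γ) (1 / ((j : ℝ≥0) + 1)) ((j : ℝ≥0) + 1 : ℝ≥0)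
      ((j : ℝ≥0) + 1 : ℝ≥0)) fun j =>
    DelayISS.exists_delay_uniformlyISS hh hA ⟨0, hA0⟩ hα₁ hα₂ hα₃ hγ
      (hV.of_le (mod_cast le_top)) hVα hdec (μ := 1 / ((j : ℝ≥0) + 1)) (Δx := (j : ℝ≥0) + 1)
      (Δw := (j : ℝ≥0) + 1) (by positivity)
  have htop : Tendsto (fun δ => (N δ : ℝ≥0) + 1) (𝓝[>] 0) atTop :=
    tendsto_atTop_mono (fun _ => le_self_add) (tendsto_natCast_atTop_atTop.comp hNtop)
  exact ⟨δs, hδs, fun δ => 1 / ((N δ : ℝ≥0) + 1), fun δ => (N δ : ℝ≥0) + 1,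
    fun δ => (N δ : ℝ≥0) + 1,
    fun δ hδ => ⟨by positivity, by positivity, by positivity, hN δ hδ⟩,
    (tendsto_one_div_add_atTop_nhds_zero_nat (𝕜 := ℝ≥0)).comp hNtop, htop, htop⟩
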